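/- Let $v\ge 0$ and $T\ge 1$ be integers, let $P(x)=x^{2\cdot 3^v}+x^{3^v}+1\in\mathbb{F}_2[x]$, and for $1\le j\le 2^T-1$ let $C_j=\langle P(x)^j\rangle$ be the ideal of $\mathbb{F}_2[x]/\langle P(x)^{2^T}\rangle$ generated by $P(x)^j$, regarded as a binary linear code of length $n=2\cdot 3^v\cdot 2^T$ by identifying the vector $(c_0,\dots,c_{n-1})$ with the class of $c_0+c_1x+\dots+c_{n-1}x^{n-1}$. Let $d_j$ denote the minimum Hamming distance of $C_j$, that is, the least Hamming distance between two distinct codewords. Then \[ d_j=\begin{cases} 2, & \text{if } 1\le j\le 2^{T-1},\\ \frac{2^{r+2}-1}{3}, & \text{if } j=2^T-2^{T-r} \text{ with } 2\le r\le T,\ r \text{ even},\\ \frac{2^{r+2}-2}{3}, & \text{if } j=2^T-2^{T-r} \text{ with } 2\le r\le T,\ r \text{ odd},\\ \frac{2^{r+3}-2}{3}, & \text{if } j=2^T-2^{T-r}+i \text{ with } 2\le r\le T-1,\ r \text{ even},\ 1\le i\le 2^{T-r-1}. \end{cases} \] Moreover, if $T\ge 2$, then \[ 4\le d_{2^{T-1}+i}\le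 5\qquad\text{for } 1\le i\le 2^{T-2}, \] and for every odd $r$ with $2\le r\le T-1$, \[ \frac{2^{r+3}-4}{3}\le d_{2^T-2^{T-r}+i}\le \frac{2^{r+3}-4}{3}+1\qquad\text{for } 1\le i\le 2^{T-r-1}. \] -/

import Mathlib

open Polynomial

noncomputable section

/-- The polynomial `c₀ + c₁ x + ⋯ + c_{n-1} x^{n-1}` attached to a vector `c` of length `n`. -/
def vecToPoly (F : Type*) [Field F] (n : ℕ) : (Fin n → F) →ₗ[F] F[X] :=
  ∑ i : Fin n, (monomial (i : ℕ)).comp (LinearMap.proj i)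

/-- The linear code of length `deg f` that corresponds to an ideal `I` of `F[x]/⟨f⟩`: the vectors
`c` whose polynomial `c₀ + c₁ x + ⋯ + c_{n-1} x^{n-1}`, `n = deg f`, represents an element of `I`.
For monic `f` these are the polycyclic codes associated with `f`. -/
def idealCode {F : Type*} [Field F] (f : F[X]) (I : Ideal (F[X] ⧸ Ideal.span {f})) :
    Submodule F (Fin f.natDegree → F) :=
  (I.restrictScalars F).comap
    ((Ideal.Quotient.mkₐ F (Ideal.span {f})).toLinearMap.comp (vecToPoly F f.natDegree))

/-- The minimum Hamming distance of a code of length `n`: the minimum of the Hamming distances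
of two distinct codewords. (It is `0`, a junk value, only if there are no two such codewords.) -/
def minHammingDist {F : Type*} [DecidableEq F] {n : ℕ} (C : Set (Fin n → F)) : ℕ :=
  sInf {d : ℕ | ∃ u ∈ C, ∃ w ∈ C, u ≠ w ∧ hammingDist u w = d}

/-- The binary trinomial `x^(2·3^v) + x^(3^v) + 1`. -/
def trinomialP (v : ℕ) : (ZMod 2)[X] := X ^ (2 * 3 ^ v) + X ^ (3 ^ v) + 1

/-- The binary polycyclic code `C_j = ⟨P^j⟩ ⊆ 𝔽₂[x]/⟨P^L⟩` with
`P = x^(2·3^v) + x^(3^v) + 1` and `L = 2^T`. -/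
def codeC (v T j : ℕ) :
    Submodule (ZMod 2) (Fin (trinomialP v ^ 2 ^ T).natDegree → ZMod 2) :=
  idealCode (trinomialP v ^ 2 ^ T)
    (Ideal.span {Ideal.Quotient.mk (Ideal.span {trinomialP v ^ 2 ^ T}) (trinomialP v ^ j)})

/-- The minimum Hamming distance `d_j` of `C_j`. -/
def distC (v T j : ℕ) : ℕ :=
  minHammingDist (codeC v T j : Set (Fin (trinomialP v ^ 2 ^ T).natDegree → ZMod 2))

end

/-! Write `P = trinomialP v`, `Q = trinomialP 0 = x^2 + x + 1`, `m = 3^v * 2^s` with `s = T - r`. By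
Frobenius, `P^(2^T - 2^s)` is `Q^(2^r - 1)` evaluated at `x^m`, so a multiple of it splits by
exponents mod `m` into multiples of `Q^(2^r - 1)`. The degree bound leaves them cofactors of degree
below 2: zero, `1`, `X` or `X + 1`. Hence the distance at this exponent is the smaller weight `w_r`
(`minTrinomialWeight`) of `Q^(2^r - 1)` and `(X + 1) * Q^(2^r - 1)`, given by a linear recursion.

For larger exponents one nonzero residue class is not enough, because its cofactor is coprime to
`P`; so the distance is at least `2 * w_r`. Up to the next threshold it is at most `w_(r+1)`, which
equals `2 * w_r` for even `r` and `2 * w_r + 1` for odd `r`. -/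

open Finset in
/-- The polynomial collecting the coefficients of `f` at the exponents `n * m + t`. -/
noncomputable def residuePart {R : Type*} [CommRing R] (m t : ℕ) (f : R[X]) : R[X] :=
  ∑ n ∈ range (f.natDegree + 1),
    if n * m + t ≤ f.natDegree then monomial n (f.coeff (n * m + t)) else 0

/-! ### Splitting a polynomial by exponents modulo `m` -/

section ResiduePart

variable {R : Type*} [CommRing R] {m t : ℕ}

theorem coeff_residuePart (hm : 0 < m) (f : R[X]) (n : ℕ) :
    (residuePart m t f).coeff n = f.coeff (n * m + t) := by
  unfold residuePart
  rw [finsetSum_coeff]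
  have h : ∀ b, (if b * m + t ≤ f.natDegree then monomial b (f.coeff (b * m + t)) else 0).coeff n
      = if b = n then f.coeff (n * m + t) else 0 := by
    intro b
    split_ifs with h1 h2 h2
    · subst h2; simp
    · simp [coeff_monomial, h2]
    · subst h2; rw [coeff_zero, coeff_eq_zero_of_natDegree_lt (by omega)]
    · simp
  simp only [h, Finset.sum_ite_eq', Finset.mem_range]
  split_ifs with h1
  · rfl
  · rw [coeff_eq_zero_of_natDegree_lt]
    nlinarith

theorem residuePart_add (hm : 0 < m) (f g : R[X]) :
    residuePart m t (f + g) = residuePart m t f + residuePart m t g := by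
  ext n; simp [coeff_residuePart hm]

/-- Multiplying by a polynomial in `x^m` does not mix exponent classes mod `m`. -/
theorem residuePart_expand_mul (ht : t < m) (g f : R[X]) :
    residuePart m t (expand R m g * f) = g * residuePart m t f := by
  have hm : 0 < m := by omega
  induction g using Polynomial.induction_on' with
  | add p q hp hq => rw [map_add, add_mul, add_mul, residuePart_add hm, hp, hq]
  | monomial k a =>
    ext n
    rw [coeff_residuePart hm, expand_monomial, ← C_mul_X_pow_eq_monomial,
      ← C_mul_X_pow_eq_monomial, mul_assoc, mul_assoc, coeff_C_mul, coeff_C_mul,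
      coeff_X_pow_mul', coeff_X_pow_mul', coeff_residuePart hm]
    by_cases h : k ≤ n
    · obtain ⟨d, rfl⟩ := Nat.exists_eq_add_of_le h
      rw [if_pos (by nlinarith), if_pos h]
      congr 2
      rw [Nat.add_sub_cancel_left, Nat.sub_eq_iff_eq_add (by nlinarith)]
      ring
    · rw [if_neg, if_neg h]
      push Not at h ⊢
      nlinarith

theorem residuePart_X_pow {k : ℕ} (hk : k < m) :
    residuePart m t (X ^ k : R[X]) = if t = k then 1 else 0 := by
  ext n
  rw [coeff_residuePart (by omega), coeff_X_pow]
  rcases Nat.eq_zero_or_pos n with rfl | hn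
  · split_ifs <;> first | omega | simp
  · rw [if_neg (by nlinarith)]
    split_ifs
    · rw [coeff_one, if_neg hn.ne']
    · simp

/-- The Hamming weight of a polynomial. -/
def polyWeight (f : R[X]) : ℕ := f.support.card

theorem polyWeight_eq_zero {f : R[X]} : polyWeight f = 0 ↔ f = 0 := by
  simp [polyWeight]

theorem polyWeight_eq_sum_residuePart (hm : 0 < m) (f : R[X]) :
    polyWeight f = ∑ t ∈ Finset.range m, polyWeight (residuePart m t f) := by
  unfold polyWeight
  rw [Finset.card_eq_sum_card_fiberwise (f := fun n => n % m) (t := Finset.range m)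
    (fun n _ => by simpa using Nat.mod_lt n hm)]
  refine Finset.sum_congr rfl fun t ht => ?_
  rw [Finset.mem_range] at ht
  symm
  refine Finset.card_bij (fun n _ => n * m + t) ?_ ?_ ?_
  · intro n hn
    rw [mem_support_iff, coeff_residuePart hm] at hn
    simp [hn, Nat.mod_eq_of_lt ht]
  · intro a _ b _ h
    exact Nat.eq_of_mul_eq_mul_right hm (by omega)
  · intro n hn
    simp only [Finset.mem_filter, mem_support_iff] at hn
    have h := Nat.div_add_mod' n m
    rw [hn.2] at h
    exact ⟨n / m, by rw [mem_support_iff, coeff_residuePart hm, h]; exact hn.1, h⟩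

theorem polyWeight_X_mul (f : R[X]) : polyWeight (X * f) = polyWeight f := by
  symm
  refine Finset.card_bij (fun n _ => n + 1) ?_ ?_ ?_
  · intro n hn; simpa using hn
  · intro a _ b _ h; omega
  · rintro (_ | n) hn
    · simp at hn
    · exact ⟨n, by simpa using hn, rfl⟩

theorem polyWeight_expand (hm : 0 < m) (f : R[X]) :
    polyWeight (expand R m f) = polyWeight f := by
  rw [polyWeight_eq_sum_residuePart hm, Finset.sum_eq_single_of_mem 0 (by simpa using hm)]
  · have h := residuePart_expand_mul hm f (X ^ 0)
    rw [residuePart_X_pow hm] at h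
    simpa using congrArg polyWeight h
  · intro t ht h0
    rw [Finset.mem_range] at ht
    have h := residuePart_expand_mul ht f (X ^ 0)
    rw [residuePart_X_pow hm, if_neg h0] at h
    rw [polyWeight_eq_zero]
    simpa using h

theorem polyWeight_expand_two_add (g h : R[X]) :
    polyWeight (expand R 2 g + X * expand R 2 h) = polyWeight g + polyWeight h := by
  have e : expand R 2 g + X * expand R 2 h = expand R 2 g * X ^ 0 + expand R 2 h * X ^ 1 := by ring
  have h0 : residuePart 2 0 (expand R 2 g + X * expand R 2 h) = g := by
    rw [e, residuePart_add two_pos, residuePart_expand_mul two_pos, residuePart_expand_mul two_pos,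
      residuePart_X_pow two_pos, residuePart_X_pow one_lt_two]
    simp
  have h1 : residuePart 2 1 (expand R 2 g + X * expand R 2 h) = h := by
    rw [e, residuePart_add two_pos, residuePart_expand_mul one_lt_two,
      residuePart_expand_mul one_lt_two,
      residuePart_X_pow two_pos, residuePart_X_pow one_lt_two]
    simp
  rw [polyWeight_eq_sum_residuePart (m := 2) two_pos]
  simp [Finset.sum_range_succ, h0, h1]

/-- A polynomial whose only nonzero residue part is the one at `t` is a shifted expansion. -/
theorem eq_X_pow_mul_expand (ht : t < m) {f : R[X]}
    (h : ∀ s < m, s ≠ t → residuePart m s f = 0) :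
    f = X ^ t * expand R m (residuePart m t f) := by
  have hm : 0 < m := by omega
  have parts : ∀ s < m, residuePart m s f =
      residuePart m s (X ^ t * expand R m (residuePart m t f)) := by
    intro s hs
    rw [mul_comm, residuePart_expand_mul hs, residuePart_X_pow ht]
    split_ifs with hst
    · rw [hst, mul_one]
    · rw [mul_zero, h s hs hst]
  ext n
  have h2 := congrArg (fun p => coeff p (n / m)) (parts (n % m) (Nat.mod_lt n hm))
  simpa only [coeff_residuePart hm, Nat.div_add_mod'] using h2

theorem natDegree_residuePart_lt {d : ℕ} (hm : 0 < m) (hd : 0 < d) {f : R[X]}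
    (hf : f.natDegree < m * d) : (residuePart m t f).natDegree < d := by
  refine lt_of_le_of_lt ?_ (Nat.sub_lt hd one_pos)
  rw [natDegree_le_iff_coeff_eq_zero]
  intro n hn
  rw [coeff_residuePart hm]
  apply coeff_eq_zero_of_natDegree_lt
  have : d ≤ n := by omega
  nlinarith

theorem exists_residuePart_ne_zero (hm : 0 < m) {f : R[X]} (h0 : f ≠ 0) :
    ∃ t < m, residuePart m t f ≠ 0 := by
  by_contra! h
  apply h0
  rw [← polyWeight_eq_zero, polyWeight_eq_sum_residuePart hm]
  exact Finset.sum_eq_zero fun t ht => polyWeight_eq_zero.2 (h t (Finset.mem_range.1 ht))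

end ResiduePart

/-! ### Weights of multiples of powers of the trinomial -/

section Trinomial

theorem natDegree_trinomialP (v : ℕ) : (trinomialP v).natDegree = 2 * 3 ^ v := by
  have h : 0 < 3 ^ v := by positivity
  unfold trinomialP
  compute_degree!

theorem trinomialP_ne_zero (v : ℕ) : trinomialP v ≠ 0 := by
  intro h
  have h1 := natDegree_trinomialP v
  rw [h, natDegree_zero] at h1
  have : 0 < 3 ^ v := by positivity
  omega

theorem expand_trinomialP_zero (v : ℕ) :
    expand (ZMod 2) (3 ^ v) (trinomialP 0) = trinomialP v := by
  simp [trinomialP, ← pow_mul, mul_comm]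

theorem expand_two_pow (s : ℕ) (f : (ZMod 2)[X]) : expand (ZMod 2) (2 ^ s) f = f ^ 2 ^ s := by
  induction s with
  | zero => simp
  | succ s ih => rw [pow_succ', expand_mul, ih, map_pow, ZMod.expand_card, ← pow_mul]

theorem expand_trinomialP_pow (v s k : ℕ) :
    expand (ZMod 2) (3 ^ v * 2 ^ s) (trinomialP 0 ^ k) = trinomialP v ^ (2 ^ s * k) := by
  rw [expand_mul, expand_two_pow, ← pow_mul, map_pow, expand_trinomialP_zero, mul_comm k]

/-- As `2^(r+1) - 1 = 2 * (2^r - 1) + 1`, the power is a square, hence a polynomial in `x^2`, times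
`x^2 + x + 1 = (x^2 + 1) + x`. -/
theorem trinomialP_pow_succ (r : ℕ) :
    trinomialP 0 ^ (2 ^ (r + 1) - 1) =
      expand (ZMod 2) 2 ((X + 1) * trinomialP 0 ^ (2 ^ r - 1)) +
        X * expand (ZMod 2) 2 (trinomialP 0 ^ (2 ^ r - 1)) := by
  have h : 2 ^ (r + 1) - 1 = (2 ^ r - 1) * 2 + 1 := by
    have := Nat.one_le_two_pow (n := r)
    omega
  rw [h, ZMod.expand_card, ZMod.expand_card, pow_succ, pow_mul, mul_pow, add_pow_char]
  generalize trinomialP 0 ^ (2 ^ r - 1) = A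
  simp only [trinomialP, pow_zero, mul_one, pow_one, one_pow]
  ring

/-- Same splitting, now with `(x + 1)(x^2 + x + 1) = 1 + x * x^2` in characteristic 2. -/
theorem X_add_one_mul_trinomialP_pow_succ (r : ℕ) :
    (X + 1) * trinomialP 0 ^ (2 ^ (r + 1) - 1) =
      expand (ZMod 2) 2 (trinomialP 0 ^ (2 ^ r - 1)) +
        X * expand (ZMod 2) 2 (X * trinomialP 0 ^ (2 ^ r - 1)) := by
  have h : 2 ^ (r + 1) - 1 = (2 ^ r - 1) * 2 + 1 := by
    have := Nat.one_le_two_pow (n := r)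
    omega
  rw [h, ZMod.expand_card, ZMod.expand_card, pow_succ, pow_mul, mul_pow]
  generalize trinomialP 0 ^ (2 ^ r - 1) = A
  simp only [trinomialP, pow_zero, mul_one, pow_one]
  linear_combination (X ^ 2 + X) * A ^ 2 * CharTwo.two_eq_zero (R := (ZMod 2)[X])

/-- The even-odd splittings give `a_(r+1) = a_r + b_r`, `b_(r+1) = 2 * a_r` for the two weights,
starting from `(1, 2)`. The sign `(-1)^r` decides which is smaller. -/
theorem three_mul_polyWeight_trinomialP_pow (r : ℕ) :
    (3 * polyWeight (trinomialP 0 ^ (2 ^ r - 1)) : ℤ) = 2 ^ (r + 2) - (-1) ^ r ∧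
    (3 * polyWeight ((X + 1) * trinomialP 0 ^ (2 ^ r - 1)) : ℤ) = 2 ^ (r + 2) + 2 * (-1) ^ r := by
  induction r with
  | zero =>
    have h1 : polyWeight (1 : (ZMod 2)[X]) = 1 := by
      rw [polyWeight, ← C_1, support_C one_ne_zero, Finset.card_singleton]
    have h2 : polyWeight (X + 1 : (ZMod 2)[X]) = 2 := by
      have := polyWeight_expand_two_add (1 : (ZMod 2)[X]) 1
      rw [map_one, mul_one, h1] at this
      rw [add_comm, this]
    simp [h1, h2]
  | succ r ih =>
    rw [X_add_one_mul_trinomialP_pow_succ, trinomialP_pow_succ, polyWeight_expand_two_add,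
      polyWeight_expand_two_add, polyWeight_X_mul]
    push_cast
    constructor
    · linear_combination ih.1 + ih.2
    · linear_combination 2 * ih.1

/-- The least weight of the nonzero multiples of `(x² + x + 1) ^ (2 ^ r - 1)` of degree less than
`2 ^ (r + 1)`. -/
noncomputable def minTrinomialWeight (r : ℕ) : ℕ :=
  min (polyWeight (trinomialP 0 ^ (2 ^ r - 1))) (polyWeight ((X + 1) * trinomialP 0 ^ (2 ^ r - 1)))

theorem three_mul_minTrinomialWeight_of_even {r : ℕ} (hr : Even r) :
    3 * minTrinomialWeight r + 1 = 2 ^ (r + 2) := by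
  have ⟨h1, h2⟩ := three_mul_polyWeight_trinomialP_pow r
  rw [hr.neg_one_pow] at h1 h2
  rw [minTrinomialWeight, min_eq_left (by omega)]
  zify
  linarith

theorem three_mul_minTrinomialWeight_of_odd {r : ℕ} (hr : Odd r) :
    3 * minTrinomialWeight r + 2 = 2 ^ (r + 2) := by
  have ⟨h1, h2⟩ := three_mul_polyWeight_trinomialP_pow r
  rw [hr.neg_one_pow] at h1 h2
  rw [minTrinomialWeight, min_eq_right (by omega)]
  zify
  linarith

theorem eq_of_natDegree_lt_two {q : (ZMod 2)[X]} (h0 : q ≠ 0) (h : q.natDegree < 2) :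
    q = 1 ∨ q = X ∨ q = X + 1 := by
  obtain ⟨a, b, rfl⟩ := exists_eq_X_add_C_of_natDegree_le_one (Nat.le_of_lt_succ h)
  have key : ∀ c : ZMod 2, c = 0 ∨ c = 1 := by decide
  rcases key a with rfl | rfl <;> rcases key b with rfl | rfl <;> simp_all

theorem exists_eq_pow_mul {r : ℕ} {f : (ZMod 2)[X]} (h0 : f ≠ 0)
    (hf : f.natDegree < 2 ^ (r + 1)) (h : trinomialP 0 ^ (2 ^ r - 1) ∣ f) :
    ∃ q, (q = 1 ∨ q = X ∨ q = X + 1) ∧ f = q * trinomialP 0 ^ (2 ^ r - 1) := by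
  obtain ⟨q, rfl⟩ := h
  refine ⟨q, eq_of_natDegree_lt_two (right_ne_zero_of_mul h0) ?_, mul_comm _ _⟩
  rw [natDegree_mul (left_ne_zero_of_mul h0) (right_ne_zero_of_mul h0), natDegree_pow,
    natDegree_trinomialP] at hf
  have := Nat.one_le_two_pow (n := r)
  omega

theorem minTrinomialWeight_le {r : ℕ} {f : (ZMod 2)[X]} (h0 : f ≠ 0)
    (hf : f.natDegree < 2 ^ (r + 1)) (h : trinomialP 0 ^ (2 ^ r - 1) ∣ f) :
    minTrinomialWeight r ≤ polyWeight f := by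
  obtain ⟨q, rfl | rfl | rfl, rfl⟩ := exists_eq_pow_mul h0 hf h
  · rw [one_mul]; exact min_le_left _ _
  · rw [polyWeight_X_mul]; exact min_le_left _ _
  · exact min_le_right _ _

theorem exists_polyWeight_eq (r : ℕ) : ∃ f : (ZMod 2)[X], f ≠ 0 ∧ f.natDegree < 2 ^ (r + 1) ∧
    trinomialP 0 ^ (2 ^ r - 1) ∣ f ∧ polyWeight f = minTrinomialWeight r := by
  have hP : trinomialP 0 ^ (2 ^ r - 1) ≠ 0 := pow_ne_zero _ (trinomialP_ne_zero 0)
  have hX : (X + 1 : (ZMod 2)[X]) ≠ 0 := X_add_C_ne_zero 1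
  have hdeg : (X + 1 : (ZMod 2)[X]).natDegree = 1 := natDegree_X_add_C 1
  have := Nat.one_le_two_pow (n := r)
  rcases min_choice (polyWeight (trinomialP 0 ^ (2 ^ r - 1)))
    (polyWeight ((X + 1) * trinomialP 0 ^ (2 ^ r - 1))) with h | h
  · refine ⟨_, hP, ?_, dvd_rfl, h.symm⟩
    rw [natDegree_pow, natDegree_trinomialP]
    omega
  · refine ⟨_, mul_ne_zero hX hP, ?_, dvd_mul_left _ _, h.symm⟩
    rw [natDegree_mul hX hP, hdeg, natDegree_pow, natDegree_trinomialP]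
    omega

theorem isCoprime_trinomialP_X (v : ℕ) : IsCoprime (trinomialP v) X := by
  obtain ⟨k, hk⟩ := Nat.exists_eq_succ_of_ne_zero (pow_ne_zero v (by decide : (3 : ℕ) ≠ 0))
  -- With `3^v = k + 1`, this is `P = X * (X^(2k+1) + X^k) + 1`.
  refine ⟨1, -(X ^ (2 * k + 1) + X ^ k), ?_⟩
  rw [trinomialP, hk, Nat.succ_eq_add_one]
  ring

theorem isCoprime_trinomialP_X_pow_add_one (v s : ℕ) :
    IsCoprime (trinomialP v) (X ^ (3 ^ v * 2 ^ s) + 1) := by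
  have h : (X ^ (3 ^ v * 2 ^ s) + 1 : (ZMod 2)[X]) = (X ^ 3 ^ v + 1) ^ 2 ^ s := by
    rw [add_pow_char_pow, one_pow, pow_mul]
  rw [h]
  -- With `y = x^(3^v)`, `P = y * (y + 1) + 1`.
  refine IsCoprime.pow_right ⟨1, -X ^ 3 ^ v, ?_⟩
  rw [trinomialP]
  ring

theorem isCoprime_trinomialP_expand (v s : ℕ) {q : (ZMod 2)[X]}
    (hq : q = 1 ∨ q = X ∨ q = X + 1) :
    IsCoprime (trinomialP v) (expand (ZMod 2) (3 ^ v * 2 ^ s) q) := by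
  rcases hq with rfl | rfl | rfl
  · rw [map_one]; exact isCoprime_one_right
  · rw [expand_X]; exact (isCoprime_trinomialP_X v).pow_right
  · rw [map_add, map_one, expand_X]; exact isCoprime_trinomialP_X_pow_add_one v s

theorem not_isUnit_trinomialP (v : ℕ) : ¬ IsUnit (trinomialP v) := by
  intro h
  have h1 := natDegree_eq_zero_of_isUnit h
  rw [natDegree_trinomialP] at h1
  have : 0 < 3 ^ v := by positivity
  omega

theorem pow_dvd_residuePart {v s r t : ℕ} (ht : t < 3 ^ v * 2 ^ s) {f : (ZMod 2)[X]}
    (h : trinomialP v ^ (2 ^ s * (2 ^ r - 1)) ∣ f) :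
    trinomialP 0 ^ (2 ^ r - 1) ∣ residuePart (3 ^ v * 2 ^ s) t f := by
  obtain ⟨g, rfl⟩ := h
  rw [← expand_trinomialP_pow, residuePart_expand_mul ht]
  exact dvd_mul_right _ _

theorem minTrinomialWeight_le_residuePart {v s r t : ℕ} (ht : t < 3 ^ v * 2 ^ s)
    {f : (ZMod 2)[X]} (hf : f.natDegree < 3 ^ v * 2 ^ s * 2 ^ (r + 1))
    (h : trinomialP v ^ (2 ^ s * (2 ^ r - 1)) ∣ f) (h0 : residuePart (3 ^ v * 2 ^ s) t f ≠ 0) :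
    minTrinomialWeight r ≤ polyWeight (residuePart (3 ^ v * 2 ^ s) t f) :=
  minTrinomialWeight_le h0 (natDegree_residuePart_lt (by positivity) (by positivity) hf)
    (pow_dvd_residuePart ht h)

theorem minTrinomialWeight_le_of_pow_dvd {v s r : ℕ} {f : (ZMod 2)[X]} (h0 : f ≠ 0)
    (hf : f.natDegree < 3 ^ v * 2 ^ s * 2 ^ (r + 1))
    (h : trinomialP v ^ (2 ^ s * (2 ^ r - 1)) ∣ f) :
    minTrinomialWeight r ≤ polyWeight f := by
  have hm : 0 < 3 ^ v * 2 ^ s := by positivity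
  obtain ⟨t, ht, hne⟩ := exists_residuePart_ne_zero hm h0
  rw [polyWeight_eq_sum_residuePart hm]
  exact (minTrinomialWeight_le_residuePart ht hf h hne).trans
    (Finset.single_le_sum (f := fun t => polyWeight (residuePart (3 ^ v * 2 ^ s) t f))
      (fun _ _ => Nat.zero_le _) (Finset.mem_range.2 ht))

/-- Two nonzero residue parts each contribute the minimum weight. The extra factor of `P` rules out
a single one. -/
theorem two_mul_minTrinomialWeight_le_of_pow_dvd {v s r : ℕ} {f : (ZMod 2)[X]} (h0 : f ≠ 0)
    (hf : f.natDegree < 3 ^ v * 2 ^ s * 2 ^ (r + 1))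
    (h : trinomialP v ^ (2 ^ s * (2 ^ r - 1) + 1) ∣ f) :
    2 * minTrinomialWeight r ≤ polyWeight f := by
  have hm : 0 < 3 ^ v * 2 ^ s := by positivity
  have h' := (pow_dvd_pow _ (Nat.le_succ _)).trans h
  obtain ⟨t, ht, hne⟩ := exists_residuePart_ne_zero hm h0
  by_cases hs : ∃ u < 3 ^ v * 2 ^ s, u ≠ t ∧ residuePart (3 ^ v * 2 ^ s) u f ≠ 0
  · obtain ⟨u, hu, hut, hune⟩ := hs
    rw [polyWeight_eq_sum_residuePart hm, two_mul]
    calc _ ≤ _ := add_le_add (minTrinomialWeight_le_residuePart ht hf h' hne)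
            (minTrinomialWeight_le_residuePart hu hf h' hune)
      _ = ∑ i ∈ {t, u}, polyWeight (residuePart (3 ^ v * 2 ^ s) i f) :=
        (Finset.sum_pair (f := fun i => polyWeight (residuePart (3 ^ v * 2 ^ s) i f)) hut.symm).symm
      _ ≤ _ := Finset.sum_le_sum_of_subset (by
        intro i hi
        simp only [Finset.mem_insert, Finset.mem_singleton] at hi
        rcases hi with rfl | rfl <;> simpa)
  · push Not at hs
    have hfe := eq_X_pow_mul_expand ht hs
    obtain ⟨q, hq, hqe⟩ := exists_eq_pow_mul hne
      (natDegree_residuePart_lt hm (by positivity) hf) (pow_dvd_residuePart ht h')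
    rw [hqe, map_mul, expand_trinomialP_pow, ← mul_assoc] at hfe
    -- After cancelling the common power, `P` would divide `X^t * q(x^m)`, to which it is coprime.
    rw [hfe, pow_succ', mul_dvd_mul_iff_right (pow_ne_zero _ (trinomialP_ne_zero v))] at h
    exact absurd ((((isCoprime_trinomialP_X v).pow_right).mul_right
      (isCoprime_trinomialP_expand v s hq)).isUnit_of_dvd' dvd_rfl h) (not_isUnit_trinomialP v)

end Trinomial

/-! ### From polynomial weights to code distances -/

section Codes

theorem coeff_vecToPoly {F : Type*} [Field F] {n : ℕ} (c : Fin n → F) (k : ℕ) :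
    (vecToPoly F n c).coeff k = if h : k < n then c ⟨k, h⟩ else 0 := by
  simp only [vecToPoly, LinearMap.sum_apply, LinearMap.comp_apply, LinearMap.proj_apply,
    finsetSum_coeff, coeff_monomial]
  split_ifs with h
  · rw [Finset.sum_eq_single ⟨k, h⟩]
    · simp
    · intro b _ hb
      rw [if_neg]
      exact fun hk => hb (Fin.ext hk)
    · simp
  · refine Finset.sum_eq_zero fun b _ => if_neg ?_
    have := b.2
    omega

theorem polyWeight_vecToPoly {F : Type*} [Field F] [DecidableEq F] {n : ℕ} (c : Fin n → F) :
    polyWeight (vecToPoly F n c) = hammingNorm c := by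
  symm
  refine Finset.card_bij (fun i _ => (i : ℕ)) ?_ ?_ ?_
  · intro i hi
    rw [mem_support_iff, coeff_vecToPoly, dif_pos i.2]
    simpa using hi
  · intro a _ b _ h
    exact Fin.ext h
  · intro k hk
    rw [mem_support_iff, coeff_vecToPoly] at hk
    split_ifs at hk with h
    · exact ⟨⟨k, h⟩, by simpa using hk, rfl⟩
    · exact absurd rfl hk

theorem natDegree_vecToPoly_lt {F : Type*} [Field F] {n : ℕ} (hn : 0 < n) (c : Fin n → F) :
    (vecToPoly F n c).natDegree < n := by
  refine lt_of_le_of_lt ?_ (Nat.sub_lt hn one_pos)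
  rw [natDegree_le_iff_coeff_eq_zero]
  intro k hk
  rw [coeff_vecToPoly, dif_neg (by omega)]

theorem vecToPoly_coeff {F : Type*} [Field F] {n : ℕ} {f : F[X]} (hf : f.natDegree < n) :
    vecToPoly F n (fun i => f.coeff i) = f := by
  ext k
  rw [coeff_vecToPoly]
  split_ifs with h
  · rfl
  · rw [coeff_eq_zero_of_natDegree_lt (by omega)]

theorem mem_codeC {v T j : ℕ} (hj : j ≤ 2 ^ T)
    (c : Fin (trinomialP v ^ 2 ^ T).natDegree → ZMod 2) :
    c ∈ codeC v T j ↔ trinomialP v ^ j ∣ vecToPoly (ZMod 2) _ c := by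
  change Ideal.Quotient.mk _ (vecToPoly (ZMod 2) _ c) ∈ Ideal.span _ ↔ _
  rw [Ideal.mem_span_singleton]
  constructor
  · rintro ⟨q, hq⟩
    obtain ⟨q, rfl⟩ := Ideal.Quotient.mk_surjective q
    rw [← map_mul, Ideal.Quotient.eq, Ideal.mem_span_singleton] at hq
    -- `P^j` divides the modulus, so divisibility lifts from the quotient.
    have := (pow_dvd_pow (trinomialP v) hj).trans hq
    exact (dvd_sub_left (dvd_mul_right _ _)).1 this
  · exact map_dvd _

theorem natDegree_trinomialP_pow (v T : ℕ) :
    (trinomialP v ^ 2 ^ T).natDegree = 3 ^ v * 2 ^ (T + 1) := by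
  rw [natDegree_pow, natDegree_trinomialP]
  ring

theorem distC_le {v T j : ℕ} (hj : j ≤ 2 ^ T) {f : (ZMod 2)[X]} (h0 : f ≠ 0)
    (hf : f.natDegree < 3 ^ v * 2 ^ (T + 1)) (h : trinomialP v ^ j ∣ f) :
    distC v T j ≤ polyWeight f := by
  rw [← natDegree_trinomialP_pow] at hf
  have e := vecToPoly_coeff hf
  refine Nat.sInf_le ⟨fun i => f.coeff i, ?_, 0, Submodule.zero_mem _, ?_, ?_⟩
  · rwa [SetLike.mem_coe, mem_codeC hj, e]
  · intro hz
    rw [hz, map_zero] at e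
    exact h0 e.symm
  · rw [hammingDist_zero_right, ← polyWeight_vecToPoly, e]

theorem le_distC {v T j k : ℕ} (hj : j < 2 ^ T)
    (H : ∀ f : (ZMod 2)[X], f ≠ 0 → f.natDegree < 3 ^ v * 2 ^ (T + 1) → trinomialP v ^ j ∣ f →
      k ≤ polyWeight f) : k ≤ distC v T j := by
  have hpos : 0 < (trinomialP v ^ 2 ^ T).natDegree := by
    rw [natDegree_trinomialP_pow]; positivity
  refine le_csInf ?_ ?_
  -- `P^j` is itself a nonzero codeword, so the infimum is not the junk value on the empty set.
  · have hd : (trinomialP v ^ j).natDegree < (trinomialP v ^ 2 ^ T).natDegree := by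
      rw [natDegree_pow, natDegree_pow]
      refine Nat.mul_lt_mul_of_pos_right hj ?_
      rw [natDegree_trinomialP]
      positivity
    have e := vecToPoly_coeff hd
    refine ⟨_, fun i => (trinomialP v ^ j).coeff i, ?_, 0, Submodule.zero_mem _, ?_, rfl⟩
    · rw [SetLike.mem_coe, mem_codeC hj.le, e]
    · intro hz
      rw [hz, map_zero] at e
      exact pow_ne_zero _ (trinomialP_ne_zero v) e.symm
  · rintro _ ⟨u, hu, w, hw, hne, rfl⟩
    rw [hammingDist_comm, hammingDist_eq_hammingNorm, neg_add_eq_sub, ← polyWeight_vecToPoly]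
    have hmem := (mem_codeC hj.le _).1 (sub_mem hu hw)
    refine H _ ?_ ?_ hmem
    · rw [Ne, ← polyWeight_eq_zero, polyWeight_vecToPoly, hammingNorm_eq_zero, sub_eq_zero]
      exact hne
    · rw [← natDegree_trinomialP_pow]
      exact natDegree_vecToPoly_lt hpos _

/-- Substituting `x^m` in an optimal multiple of `Q^(2^r - 1)` preserves its weight and gives a
codeword. -/
theorem distC_le_minTrinomialWeight {v T r j : ℕ} (hr : r ≤ T)
    (hj : j ≤ 2 ^ T - 2 ^ (T - r)) : distC v T j ≤ minTrinomialWeight r := by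
  obtain ⟨s, rfl⟩ := Nat.exists_eq_add_of_le' hr
  rw [Nat.add_sub_cancel] at hj
  obtain ⟨f, h0, hf, hdvd, hw⟩ := exists_polyWeight_eq r
  have hm : 0 < 3 ^ v * 2 ^ s := by positivity
  rw [← hw, ← polyWeight_expand hm f]
  refine distC_le (hj.trans (Nat.sub_le _ _)) ?_ ?_ ?_
  · rwa [Ne, expand_eq_zero hm]
  · rw [natDegree_expand, show 3 ^ v * 2 ^ (s + r + 1) = 2 ^ (r + 1) * (3 ^ v * 2 ^ s) by ring]
    exact Nat.mul_lt_mul_of_pos_right hf hm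
  · have h := map_dvd (expand (ZMod 2) (3 ^ v * 2 ^ s)) hdvd
    rw [expand_trinomialP_pow, Nat.mul_sub, ← pow_add, mul_one] at h
    exact (pow_dvd_pow _ hj).trans h

theorem minTrinomialWeight_le_distC {v T r : ℕ} (hr : r ≤ T) :
    minTrinomialWeight r ≤ distC v T (2 ^ T - 2 ^ (T - r)) := by
  obtain ⟨s, rfl⟩ := Nat.exists_eq_add_of_le' hr
  rw [Nat.add_sub_cancel]
  refine le_distC (Nat.sub_lt (by positivity) (by positivity)) fun f h0 hf h =>
    minTrinomialWeight_le_of_pow_dvd (v := v) (s := s) h0 ?_ ?_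
  · rwa [mul_assoc, ← pow_add, ← add_assoc]
  · rwa [Nat.mul_sub, ← pow_add, mul_one]

theorem two_mul_minTrinomialWeight_le_distC {v T r j : ℕ} (hr : r ≤ T)
    (hj : 2 ^ T - 2 ^ (T - r) < j) (hjT : j < 2 ^ T) :
    2 * minTrinomialWeight r ≤ distC v T j := by
  obtain ⟨s, rfl⟩ := Nat.exists_eq_add_of_le' hr
  rw [Nat.add_sub_cancel] at hj
  refine le_distC hjT fun f h0 hf h =>
    two_mul_minTrinomialWeight_le_of_pow_dvd (v := v) (s := s) h0 ?_ ((pow_dvd_pow _ ?_).trans h)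
  · rwa [mul_assoc, ← pow_add, ← add_assoc]
  · rwa [Nat.mul_sub, ← pow_add, mul_one]

theorem distC_eq_minTrinomialWeight {v T r : ℕ} (hr : r ≤ T) :
    distC v T (2 ^ T - 2 ^ (T - r)) = minTrinomialWeight r :=
  le_antisymm (distC_le_minTrinomialWeight hr le_rfl) (minTrinomialWeight_le_distC hr)

theorem distC_add_bounds (v : ℕ) {T r i : ℕ} (hr : r + 1 ≤ T) (h1 : 1 ≤ i)
    (hi : i ≤ 2 ^ (T - r - 1)) :
    2 * minTrinomialWeight r ≤ distC v T (2 ^ T - 2 ^ (T - r) + i) ∧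
      distC v T (2 ^ T - 2 ^ (T - r) + i) ≤ minTrinomialWeight (r + 1) := by
  have e : 2 ^ (T - r) = 2 * 2 ^ (T - r - 1) := by rw [← pow_succ']; congr 1; omega
  have hle : 2 ^ (T - r) ≤ 2 ^ T := Nat.pow_le_pow_right two_pos (Nat.sub_le _ _)
  have hpos : 0 < 2 ^ (T - r - 1) := by positivity
  constructor
  · exact two_mul_minTrinomialWeight_le_distC (by omega) (by omega) (by omega)
  · refine distC_le_minTrinomialWeight hr ?_
    rw [← Nat.sub_sub T r 1]
    omega

end Codes

/-! ### The distance formulas -/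

theorem theorem20 (v T : ℕ) (hT : 1 ≤ T) :
    (∀ j : ℕ, 1 ≤ j → j ≤ 2 ^ (T - 1) → distC v T j = 2) ∧
    (∀ r : ℕ, 2 ≤ r → r ≤ T → Even r →
      (distC v T (2 ^ T - 2 ^ (T - r)) : ℚ) = (2 ^ (r + 2) - 1) / 3) ∧
    (∀ r : ℕ, 2 ≤ r → r ≤ T → Odd r →
      (distC v T (2 ^ T - 2 ^ (T - r)) : ℚ) = (2 ^ (r + 2) - 2) / 3) ∧
    (∀ r : ℕ, 2 ≤ r → r + 1 ≤ T → Even r → ∀ i : ℕ, 1 ≤ i → i ≤ 2 ^ (T - r - 1) →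
      (distC v T (2 ^ T - 2 ^ (T - r) + i) : ℚ) = (2 ^ (r + 3) - 2) / 3) ∧
    (2 ≤ T → ∀ i : ℕ, 1 ≤ i → i ≤ 2 ^ (T - 2) →
      4 ≤ distC v T (2 ^ (T - 1) + i) ∧ distC v T (2 ^ (T - 1) + i) ≤ 5) ∧
    (∀ r : ℕ, 2 ≤ r → r + 1 ≤ T → Odd r → ∀ i : ℕ, 1 ≤ i → i ≤ 2 ^ (T - r - 1) →
      ((2 ^ (r + 3) - 4) / 3 : ℚ) ≤ (distC v T (2 ^ T - 2 ^ (T - r) + i) : ℚ) ∧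
      (distC v T (2 ^ T - 2 ^ (T - r) + i) : ℚ) ≤ (2 ^ (r + 3) - 4) / 3 + 1) := by
  refine ⟨?_, ?_, ?_, ?_, ?_, ?_⟩
  · intro j h1 hj
    have e : 2 ^ T = 2 * 2 ^ (T - 1) := by rw [← pow_succ', Nat.sub_add_cancel hT]
    have hpos : 0 < 2 ^ (T - 1) := by positivity
    -- Doubling at `r = 0` and the upper bound at `r = 1` meet: `2 * w_0 = w_1 = 2`.
    have w0 := three_mul_minTrinomialWeight_of_even (r := 0) (by decide)
    have w1 := three_mul_minTrinomialWeight_of_odd (r := 1) (by decide)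
    have hu := distC_le_minTrinomialWeight (v := v) (j := j) hT (by omega)
    have hl := two_mul_minTrinomialWeight_le_distC (v := v) (j := j) (Nat.zero_le T)
      (by rw [Nat.sub_zero, Nat.sub_self]; omega) (by omega)
    norm_num at w0 w1
    omega
  · intro r _ hrT hr
    rw [distC_eq_minTrinomialWeight hrT, eq_div_iff three_ne_zero, eq_sub_iff_add_eq, mul_comm]
    exact_mod_cast three_mul_minTrinomialWeight_of_even hr
  · intro r _ hrT hr
    rw [distC_eq_minTrinomialWeight hrT, eq_div_iff three_ne_zero, eq_sub_iff_add_eq, mul_comm]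
    exact_mod_cast three_mul_minTrinomialWeight_of_odd hr
  · intro r _ hrT hr i h1 hi
    have hw := three_mul_minTrinomialWeight_of_even hr
    have hw' := three_mul_minTrinomialWeight_of_odd hr.add_one
    have hb := distC_add_bounds v hrT h1 hi
    rw [eq_div_iff three_ne_zero, eq_sub_iff_add_eq, mul_comm]
    have : 3 * distC v T (2 ^ T - 2 ^ (T - r) + i) + 2 = 2 ^ (r + 3) := by
      rw [show r + 1 + 2 = r + 2 + 1 from rfl, pow_succ] at hw'
      rw [show r + 3 = r + 2 + 1 from rfl, pow_succ]
      omega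
    exact_mod_cast this
  · intro hT2 i h1 hi
    have e : 2 ^ T = 2 * 2 ^ (T - 1) := by rw [← pow_succ', Nat.sub_add_cancel hT]
    -- The case `r = 1`: `2 * w_1 = 4` and `w_2 = 5`.
    have hb := distC_add_bounds v (r := 1) hT2 h1 hi
    rw [show 2 ^ T - 2 ^ (T - 1) = 2 ^ (T - 1) by omega] at hb
    have w1 := three_mul_minTrinomialWeight_of_odd (r := 1) (by decide)
    have w2 := three_mul_minTrinomialWeight_of_even (r := 2) (by decide)
    norm_num at w1 w2 hb
    omega
  · intro r _ hrT hr i h1 hi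
    have hw := three_mul_minTrinomialWeight_of_odd hr
    have hw' := three_mul_minTrinomialWeight_of_even hr.add_one
    have hb := distC_add_bounds v hrT h1 hi
    have hl : 2 ^ (r + 3) ≤ 3 * distC v T (2 ^ T - 2 ^ (T - r) + i) + 4 := by
      rw [show r + 3 = r + 2 + 1 from rfl, pow_succ]
      omega
    have hu : 3 * distC v T (2 ^ T - 2 ^ (T - r) + i) + 1 ≤ 2 ^ (r + 3) := by
      rw [show r + 1 + 2 = r + 3 from rfl] at hw'
      omega
    have hl' : (2 ^ (r + 3) : ℚ) ≤ 3 * distC v T (2 ^ T - 2 ^ (T - r) + i) + 4 := by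
      exact_mod_cast hl
    have hu' : (3 * distC v T (2 ^ T - 2 ^ (T - r) + i) + 1 : ℚ) ≤ 2 ^ (r + 3) := by
      exact_mod_cast hu
    constructor <;> linarith
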